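/- Let $n\geq 1$ be an integer and let $\mathcal{M}_n$ denote the space of all complex $n\times n$ matrices. Let $T:\mathcal{M}_n\rightarrow\mathcal{M}_n$ be an $\mathbb{R}$-linear mapping (that is, additive and homogeneous with respect to real scalars) such that for every $x\in\mathcal{M}_n$ the matrices $T(x)$ and $x$ have at least one common eigenvalue in $\mathbb{C}$. Then $T$ is $\mathbb{C}$-linear. -/

import Mathlib

/-! `T` preserves characteristic polynomials. Join `x` to a pencil `a + s b` whose characteristic
polynomial is irreducible over `ℂ[s]`: that of `(1 - r) x + r (a + s b)` is then irreducible over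
`ℂ[s][r]`. It shares a root with its image under `T` at all real `r`, `s`, so their resultant
vanishes and they agree; put `r = 0`. Hence `T` preserves `tr (x²)`, and by polarisation the
nondegenerate form `tr (x y)`, which forces `ℂ`-linearity. -/

open Polynomial in
/-- If a monic irreducible `p` and a monic `q` of the same degree acquire a common root under
sufficiently many specialisations of the coefficients, then they are equal. -/
theorem Polynomial.Monic.eq_of_irreducible_of_common_root {R K : Type*} [CommRing R] [IsDomain R]
    [IsIntegrallyClosed R] [CommRing K] (S : Set (R →+* K))
    (hS : ∀ c : R, (∀ φ ∈ S, φ c = 0) → c = 0) {p q : R[X]} (hp : p.Monic) (hq : q.Monic)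
    (hirr : Irreducible p) (hdeg : p.natDegree = q.natDegree)
    (hroot : ∀ φ ∈ S, ∃ z, (p.map φ).IsRoot z ∧ (q.map φ).IsRoot z) : p = q := by
  have hp0 : p.natDegree ≠ 0 := fun h =>
    hirr.not_isUnit (by rw [eq_one_of_monic_natDegree_zero hp h]; exact isUnit_one)
  have hres : resultant p q = 0 := by
    obtain ⟨a, b, -, -, hab⟩ := exists_mul_add_mul_eq_C_resultant p q le_rfl le_rfl (Or.inl hp0)
    refine hS _ fun φ hφ => ?_
    obtain ⟨z, hz, hz'⟩ := hroot φ hφ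
    have := congrArg (fun f => (f.map φ).eval z) hab
    simpa [Polynomial.map_mul, hz.eq_zero, hz'.eq_zero] using this.symm
  let F := FractionRing R
  have hresF : resultant (p.map (algebraMap R F)) (q.map (algebraMap R F)) = 0 := by
    rw [hp.natDegree_map, hq.natDegree_map, resultant_map_map, hres, map_zero]
  have hirrF := (hp.irreducible_iff_irreducible_map_fraction_map (K := F)).1 hirr
  have hdvdF : p.map (algebraMap R F) ∣ q.map (algebraMap R F) := by_contra fun h =>
    (resultant_eq_zero_iff.1 hresF).2 (hirrF.coprime_iff_not_dvd.2 h)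
  have hdvd := hq.dvd_of_fraction_map_dvd_fraction_map (K := F) hp hdvdF
  exact (eq_of_monic_of_dvd_of_natDegree_le hp hq hdvd hdeg.ge).symm

open Polynomial in
theorem Polynomial.irreducible_X_pow_sub_C_X {K : Type*} [Field K] {n : ℕ} (hn : n ≠ 0) :
    Irreducible (X ^ n - C X : K[X][X]) := by
  have hm : (X ^ n - C X : K[X][X]).Monic := monic_X_pow_sub_C _ hn
  have hd : (X ^ n - C X : K[X][X]).degree = n := degree_X_pow_sub_C (by lia) _
  refine irreducible_of_eisenstein_criterion (P := Ideal.span {X})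
    ((Ideal.span_singleton_prime X_ne_zero).2 prime_X) ?_ ?_ ?_ ?_ hm.isPrimitive
  · rw [hm.leadingCoeff, Ideal.mem_span_singleton]
    exact prime_X.not_dvd_one
  · intro k hk
    rw [hd] at hk
    have hk' : k ≠ n := (by exact_mod_cast hk : k < n).ne
    rw [Ideal.mem_span_singleton, coeff_sub, coeff_X_pow, if_neg hk', coeff_C]
    split_ifs <;> simp
  · rw [hd]; exact_mod_cast Nat.pos_of_ne_zero hn
  · rw [Ideal.span_singleton_pow, Ideal.mem_span_singleton, X_pow_dvd_iff]
    intro h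
    have := h 1 (by lia)
    simp [coeff_X_pow, hn.symm] at this

open Polynomial in
/-- There is an affine line of matrices whose characteristic polynomial is `t ^ n - s`. -/
theorem Matrix.exists_irreducible_charpoly_pencil {K : Type*} [Field K] {n : ℕ} (hn : n ≠ 0) :
    ∃ a b : Matrix (Fin n) (Fin n) K,
      Irreducible (a.map C + (X : K[X]) • b.map C : Matrix (Fin n) (Fin n) K[X]).charpoly := by
  set f : K[X][X] := X ^ n - C X with hf
  have hm : f.Monic := monic_X_pow_sub_C _ hn
  have hirr : Irreducible f := irreducible_X_pow_sub_C_X hn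
  have : IsDomain (AdjoinRoot f) := AdjoinRoot.isDomain_of_prime hirr.prime
  let pb := AdjoinRoot.powerBasis' hm
  have hdim : pb.dim = n := by
    simp [pb, AdjoinRoot.powerBasis', hf]
  have hmin : minpoly K[X] pb.gen = f := by
    refine (eq_of_monic_of_dvd_of_natDegree_le (minpoly.monic pb.isIntegral_gen) hm ?_ ?_).symm
    · have : Module.IsTorsionFree K[X] (AdjoinRoot f) :=
        have := hm.free_adjoinRoot; inferInstance
      refine minpoly.isIntegrallyClosed_dvd pb.isIntegral_gen ?_
      simp [pb, AdjoinRoot.powerBasis']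
    · rw [pb.natDegree_minpoly]; exact le_rfl
  -- The companion matrix of `t ^ n - s`, with its corner entry `s` split off into `b`.
  refine ⟨Matrix.of fun i j => if (j : ℕ) + 1 = n then 0 else if (i : ℕ) = j + 1 then 1 else 0,
    Matrix.of fun i j => if (j : ℕ) + 1 = n ∧ (i : ℕ) = 0 then 1 else 0, ?_⟩
  convert hirr
  rw [← hmin, ← charpoly_leftMulMatrix pb, ← Matrix.charpoly_reindex (finCongr hdim),
    pb.leftMulMatrix]
  congr 1
  ext1 i j
  have hi := i.2.ne
  simp only [PowerBasis.minpolyGen_eq, hmin, hdim]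
  simp only [hf, Matrix.add_apply, Matrix.map_apply, Matrix.smul_apply, Matrix.of_apply,
    Matrix.reindex_apply, Matrix.submatrix_apply, coeff_sub, coeff_X_pow, coeff_C]
  simp only [finCongr_symm, finCongr_apply, Fin.val_cast, hi, if_false]
  by_cases h1 : (j : ℕ) + 1 = n <;> by_cases h2 : (i : ℕ) = 0 <;> simp [h1, h2]

-- `det (t² - M²) = det (t - M) det (t + M)`, and every scalar is a square `t²`.
open Polynomial in
theorem Matrix.trace_sq_eq_of_charpoly_eq {K ι : Type*} [Field K] [IsAlgClosed K] [Fintype ι]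
    [DecidableEq ι] {A B : Matrix ι ι K} (h : A.charpoly = B.charpoly) :
    (A * A).trace = (B * B).trace := by
  have key (M : Matrix ι ι K) (t : K) : (M * M).charpoly.eval (t * t) =
      M.charpoly.eval t * ((-1) ^ Fintype.card ι * M.charpoly.eval (-t)) := by
    rw [eval_charpoly, eval_charpoly, eval_charpoly, ← det_neg, ← det_mul]
    congr 1
    simp only [map_mul, map_neg]
    have := (scalar_commute t (fun _ => mul_comm _ _) M).eq
    noncomm_ring [this]
  have hsq : (A * A).charpoly = (B * B).charpoly := by
    refine Polynomial.funext fun z => ?_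
    obtain ⟨t, rfl⟩ := IsAlgClosed.exists_eq_mul_self z
    rw [key, key, h]
  rw [trace_eq_sum_roots_charpoly, trace_eq_sum_roots_charpoly, hsq]

open Polynomial in
theorem Polynomial.eq_zero_of_evalEval_ofReal_eq_zero {c : ℂ[X][X]}
    (h : ∀ r s : ℝ, evalEval (s : ℂ) (r : ℂ) c = 0) : c = 0 := by
  have hinf : (Set.range ((↑) : ℝ → ℂ)).Infinite := Set.infinite_range_of_injective
    Complex.ofReal_injective
  have h1 (r : ℝ) : c.eval (C (r : ℂ)) = 0 := by
    refine eq_zero_of_infinite_isRoot _ (hinf.mono ?_)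
    rintro _ ⟨s, rfl⟩
    exact h r s
  refine eq_zero_of_infinite_isRoot _ ((hinf.image C_injective.injOn).mono ?_)
  rintro _ ⟨_, ⟨r, rfl⟩, rfl⟩
  exact h1 r

open Polynomial in
/-- A real-linear map preserving at least one eigenvalue of every complex matrix preserves
characteristic polynomials. -/
theorem Matrix.charpoly_eq_of_common_eigenvalue {n : ℕ} (hn : n ≠ 0)
    (T : Matrix (Fin n) (Fin n) ℂ →ₗ[ℝ] Matrix (Fin n) (Fin n) ℂ)
    (hT : ∀ x, ∃ μ : ℂ, (T x).charpoly.IsRoot μ ∧ x.charpoly.IsRoot μ)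
    (x : Matrix (Fin n) (Fin n) ℂ) : (T x).charpoly = x.charpoly := by
  obtain ⟨a, b, hab⟩ := exists_irreducible_charpoly_pencil (K := ℂ) hn
  let W (x a b : Matrix (Fin n) (Fin n) ℂ) : Matrix (Fin n) (Fin n) ℂ[X][X] :=
    (1 - X : ℂ[X][X]) • x.map (fun z => C (C z)) +
      (X : ℂ[X][X]) • (a.map C + (X : ℂ[X]) • b.map C).map C
  have hW (x a b) (φ : ℂ[X][X] →+* ℂ) (r s : ℝ) (hφ : φ = evalEvalRingHom (s : ℂ) (r : ℂ)) :
      (W x a b).map φ = (1 - r) • x + r • (a + s • b) := by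
    ext i j
    simp [W, hφ]
    ring
  have hirr : Irreducible (W x a b).charpoly := by
    -- At `r = 1` only the irreducible pencil remains.
    refine (charpoly_monic _).irreducible_of_irreducible_map (evalRingHom (1 : ℂ[X])) _ ?_
    rw [← charpoly_map]
    convert hab
    ext1 i j
    simp [W]
  have heq : (W x a b).charpoly = (W (T x) (T a) (T b)).charpoly := by
    refine (charpoly_monic _).eq_of_irreducible_of_common_root
      {φ | ∃ r s : ℝ, φ = evalEvalRingHom (s : ℂ) (r : ℂ)} ?_ (charpoly_monic _) hirr
      (by simp [charpoly_natDegree_eq_dim]) ?_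
    · intro c hc
      exact eq_zero_of_evalEval_ofReal_eq_zero fun r s => hc _ ⟨r, s, rfl⟩
    · rintro φ ⟨r, s, hφ⟩
      rw [← charpoly_map, ← charpoly_map,
        hW _ _ _ φ r s hφ, hW _ _ _ φ r s hφ]
      obtain ⟨μ, h1, h2⟩ := hT ((1 - r) • x + r • (a + s • b))
      exact ⟨μ, h2, by simpa only [map_add, map_smul] using h1⟩
  have h0 := congrArg (Polynomial.map (evalEvalRingHom ((0 : ℝ) : ℂ) ((0 : ℝ) : ℂ))) heq
  rw [← charpoly_map, ← charpoly_map,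
    hW _ _ _ _ 0 0 rfl, hW _ _ _ _ 0 0 rfl] at h0
  simpa using h0.symm

theorem Matrix.isLinearMap_of_trace_sq_eq {ι : Type*} [Fintype ι] [DecidableEq ι]
    (T : Matrix ι ι ℂ →ₗ[ℝ] Matrix ι ι ℂ) (hT : ∀ x, (T x * T x).trace = (x * x).trace) :
    IsLinearMap ℂ (T : Matrix ι ι ℂ → Matrix ι ι ℂ) := by
  have hpol (x y) : (T x * T y).trace = (x * y).trace := by
    have h := hT (x + y)
    simp only [map_add, add_mul, mul_add, trace_add, hT, trace_mul_comm (T y) (T x),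
      trace_mul_comm y x] at h
    linear_combination h / 2
  have hinj : Function.Injective T := by
    rw [injective_iff_map_eq_zero]
    intro x hx
    refine ext_iff_trace_mul_right.2 fun y => ?_
    rw [← hpol, hx]
    simp
  have hsurj : Function.Surjective T := LinearMap.injective_iff_surjective.1 hinj
  refine ⟨T.map_add, fun c x => ext_iff_trace_mul_right.2 fun y => ?_⟩
  -- Testing against `T y` moves `c` through the `ℂ`-bilinear form `tr (x y)`.
  obtain ⟨y, rfl⟩ := hsurj y
  simp [hpol]

theorem lemma2 (n : ℕ) (hn : 1 ≤ n)
    (T : Matrix (Fin n) (Fin n) ℂ →ₗ[ℝ] Matrix (Fin n) (Fin n) ℂ)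
    (hT : ∀ x : Matrix (Fin n) (Fin n) ℂ, ∃ μ : ℂ,
      Module.End.HasEigenvalue (Matrix.toLin' (T x)) μ ∧
        Module.End.HasEigenvalue (Matrix.toLin' x) μ) :
    IsLinearMap ℂ (T : Matrix (Fin n) (Fin n) ℂ → Matrix (Fin n) (Fin n) ℂ) := by
  refine Matrix.isLinearMap_of_trace_sq_eq T fun x => Matrix.trace_sq_eq_of_charpoly_eq
    (Matrix.charpoly_eq_of_common_eigenvalue (by lia) T (fun x => ?_) x)
  simpa only [Module.End.hasEigenvalue_iff_isRoot_charpoly, Matrix.charpoly_toLin'] using hT x
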